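/- There are agents $N=\{1,\dots,n\}$ and alternatives $A=\{a_1,\dots,a_m\}$. For $M>0$ let $V=V^M$ be the set of valuation profiles $v=(v_i)_{i\in N}$ with $v_i:A\to(-\frac M2,\frac M2)$. A deterministic mechanism $\langle f,\mathbf p\rangle$ consists of $f:V\to A$ and payments $p_i:V\to\mathbb R$ $(i\in N)$; utilities are $v_i(f(v))-p_i(v)$. It is *strategyproof* if $v_i(f(v_i,v_{-i}))-p_i(v_i,v_{-i})\ge v_i(f(v_i',v_{-i}))-p_i(v_i',v_{-i})$ always. For a permutation $\pi$ of $A$ let $\pi(v)$ be the profile in which $\pi(a)$ has the values that $a$ has in $v$, and call $v$ *tie-free* if $f$ is constant near $v$. The mechanism is *neutral* (up to tie-breaking) if $f(\pi(v))=\pi(f(v))$ and $p_i(\pi(v))=p_i(v)$ for all $i$, whenever $\pi(v)\ne v$ and $v$, $\pi(v)$ are tie-free. Let $$T_1(f,v)=\max_{a\in A}\sum_{i\in N}v_i(a)-\sum_{i\in N}v_i(f(v)),\qquad T_2(\mathbf p,v)=\Big|\sum_{i\in N}p_i(v)\Big|,$$ and for $\lambda\in[0,1]$ and mechanisms $\langle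 f,\mathbf p\rangle$ given for every $M>0$ (for instance as restrictions of one mechanism on all real-valued profiles), let the efficiency–budget spillover be $$\rho_n(f,\mathbf p)=\lim_{M\to\infty}\frac1{nM}\sup_{v\in V^M}\big[\lambda T_1(f,v)+(1-\lambda)T_2(\mathbf p,v)\big]\in[0,\infty].$$ The *sink mechanism* with sink agent $s$ chooses, by a rule that does not depend on $v_s$, an alternative maximizing $\sum_{i\ne s}v_i(a)$ (ties broken arbitrarily); agents $i\ne s$ pay $\max_a\sum_{j\ne s,i}v_j(a)-\sum_{j\ne s,i}v_j(f(v))$, and $s$ receives the sum of these payments. The *VCG mechanism* chooses an alternative maximizing $\sum_i v_i(a)$ (ties broken arbitrarily), and agent $i$ pays $\max_a\sum_{j\ne i}v_j(a)-\sum_{j\ne i}v_j(f(v))$. **Theorem.** (a) For every $\lambda\in(0,1)$ there is a constant $c>0$, depending only on $\lambda$, such that for all $n\ge2$ and $m\ge2$ every deterministic, strategyproof and neutral mechanism satisfies $\rho_n(f,\mathbf p)\ge\frac cn$ (with $\liminf_{M\to\infty}$ in place of the limit, if the limit does not exist). This rate is tight: for all $n,m\ge2$ and every agent $s$ there is a sink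 mechanism with sink $s$ that is strategyproof and neutral and has $\rho_n(f,\mathbf p)=\frac\lambda n$. (b) For $\lambda=0$, $n\ge 2$, $m\ge1$ and every agent $s$, sink mechanisms with sink $s$ exist, and each is strategyproof, neutral and budget balanced ($\sum_i p_i(v)=0$ for all $v$) and has $\rho_n(f,\mathbf p)=0$. (c) For $\lambda=1$ and $n,m\ge1$, VCG mechanisms exist, and each is strategyproof and neutral and has $\rho_n(f,\mathbf p)=0$. -/

import Mathlib

open Filter Topology
open scoped ENNReal

noncomputable section

/-- Valuation profiles of `n` agents over `m` alternatives with values in the open interval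
`(-M/2, M/2)`; `v i a` is the value of agent `i` for alternative `a`. -/
def Profiles (n m : ℕ) (M : ℝ) : Set (Fin n → Fin m → ℝ) :=
  {v | ∀ i a, v i a ∈ Set.Ioo (-(M / 2)) (M / 2)}

/-- A deterministic mechanism: a social choice function and a payment for every agent. -/
structure Mechanism (n m : ℕ) (M : ℝ) where
  choice : Profiles n m M → Fin m
  payment : Fin n → Profiles n m M → ℝ

/-- Relabelling the alternatives of a profile: what `a` was worth, `π a` is now worth. -/
def permuteProfile {n m : ℕ} {M : ℝ} (π : Equiv.Perm (Fin m)) (v : Profiles n m M) :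
    Profiles n m M :=
  ⟨fun i a => v.1 i (π.symm a), fun i a => v.2 i (π.symm a)⟩

namespace Mechanism

variable {n m : ℕ} {M : ℝ}

/-- No agent gains (quasi-linear utility) by misreporting, whatever the others report. -/
def Strategyproof (μ : Mechanism n m M) : Prop :=
  ∀ (i : Fin n) (v v' : Profiles n m M), (∀ j, j ≠ i → v'.1 j = v.1 j) →
    v.1 i (μ.choice v') - μ.payment i v' ≤ v.1 i (μ.choice v) - μ.payment i v

/-- The outcome at `v` is not a matter of tie-breaking: all sufficiently close profiles have
the same outcome. -/
def TieFree (μ : Mechanism n m M) (v : Profiles n m M) : Prop :=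
  ∀ᶠ v' in 𝓝 v, μ.choice v' = μ.choice v

/-- Neutrality, up to tie-breaking: relabelling the alternatives relabels the outcome and leaves
the payments unchanged. (Demanding this at ties too would exclude every mechanism
that maximizes welfare, since indistinguishable alternatives cannot be told apart.) -/
def Neutral (μ : Mechanism n m M) : Prop :=
  ∀ (π : Equiv.Perm (Fin m)) (v : Profiles n m M), permuteProfile π v ≠ v →
    μ.TieFree v → μ.TieFree (permuteProfile π v) →
      π (μ.choice v) = μ.choice (permuteProfile π v) ∧
      ∀ i, μ.payment i (permuteProfile π v) = μ.payment i v

def BudgetBalanced (μ : Mechanism n m M) : Prop :=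
  ∀ v, ∑ i, μ.payment i v = 0

/-- Welfare loss at `v` (the supremum is a maximum over finitely many alternatives). -/
def inefficiency (μ : Mechanism n m M) (v : Profiles n m M) : ℝ :=
  (⨆ a : Fin m, ∑ i, v.1 i a) - ∑ i, v.1 i (μ.choice v)

def imbalance (μ : Mechanism n m M) (v : Profiles n m M) : ℝ :=
  |∑ i, μ.payment i v|

/-- The normalized worst-case combination of inefficiency and budget imbalance, for valuation
bound `M`; it is `∞` if the combination is unbounded over the profiles. -/
def spilloverAt (lam : ℝ) (μ : Mechanism n m M) : ℝ≥0∞ :=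
  (⨆ v : Profiles n m M,
    ENNReal.ofReal (lam * μ.inefficiency v + (1 - lam) * μ.imbalance v)) /
      ENNReal.ofReal (n * M)

/-- The sink mechanism with the single sink agent `s`: the choice ignores the sink and maximizes
the welfare of the others (ties broken in any way), who pay the Clarke payments of the economy
without `s`; the sink receives the sum of their payments. -/
structure IsSinkMechanism (s : Fin n) (μ : Mechanism n m M) : Prop where
  ignores_sink : ∀ v v' : Profiles n m M, (∀ j, j ≠ s → v'.1 j = v.1 j) →
    μ.choice v' = μ.choice v
  efficient_without_sink : ∀ (v : Profiles n m M) (a : Fin m),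
    ∑ i ∈ Finset.univ.erase s, v.1 i a ≤ ∑ i ∈ Finset.univ.erase s, v.1 i (μ.choice v)
  payment_of_others : ∀ (v : Profiles n m M) (i : Fin n), i ≠ s →
    μ.payment i v = (⨆ a : Fin m, ∑ j ∈ (Finset.univ.erase s).erase i, v.1 j a) -
      ∑ j ∈ (Finset.univ.erase s).erase i, v.1 j (μ.choice v)
  payment_of_sink : ∀ v : Profiles n m M,
    μ.payment s v = -∑ i ∈ Finset.univ.erase s, μ.payment i v

/-- The Vickrey-Clarke-Groves mechanism: an efficient choice (ties broken in any way) with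
the Clarke payments. -/
structure IsVCG (μ : Mechanism n m M) : Prop where
  efficient : ∀ (v : Profiles n m M) (a : Fin m), ∑ i, v.1 i a ≤ ∑ i, v.1 i (μ.choice v)
  clarke_payment : ∀ (v : Profiles n m M) (i : Fin n),
    μ.payment i v = (⨆ a : Fin m, ∑ j ∈ Finset.univ.erase i, v.1 j a) -
      ∑ j ∈ Finset.univ.erase i, v.1 j (μ.choice v)

/-- The efficiency-budget spillover of a mechanism (given for every valuation bound `M`) is `r`:
the limit as `M → ∞` exists and equals `r`. -/
def HasSpillover (lam : ℝ) (μ : ∀ M : ℝ, Mechanism n m M) (r : ℝ≥0∞) : Prop :=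
  Tendsto (fun M : ℝ => (μ M).spilloverAt lam) atTop (𝓝 r)

end Mechanism

end

/-! Lower bound: restrict to profiles in which only two alternatives `a`, `b` matter, every agent
has a high or a low value for `a`, and `T` is the set of high agents. If the welfare loss is always
below `M / 64`, the choice is `b` for `|T| ≤ k` and `a` for `|T| > k`. Strategyproofness then fixes
how payments vary: agent `i` joining `T` leaves `i`'s payment unchanged unless `|T| = k`, when it
jumps by at least `M / 16`. In the sum of total payments over all `T` with alternating signs,
everything but these jumps cancels. There are `n * (n - 1).choose k` jumps, which for central `k` is
at least half the number `2 ^ n` of profiles, so some total payment is of order `M`, uniformly in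
`n`. This is `Strategyproof.exists_le_inefficiency_or_imbalance`; normalizing by `n * M` gives the
rate `1 / n`.

Upper bounds: VCG and sink mechanisms both charge Clarke payments within a group (`IsClarke`),
everyone or everyone but the sink. Ignoring the sink costs at most the width `M` of its value range.
-/

theorem Finset.mul_choose_le_of_alternating {n k : ℕ} (p : Fin n → Finset (Fin n) → ℝ) {τ B : ℝ}
    (hconst : ∀ i T, i ∉ T → T.card ≠ k → p i (insert i T) = p i T)
    (hstep : ∀ i T, i ∉ T → T.card = k → τ ≤ p i (insert i T) - p i T)
    (hB : ∀ T, |∑ i, p i T| ≤ B) :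
    (n : ℝ) * ((n - 1).choose k : ℝ) * τ ≤ 2 ^ n * B := by
  have key : ∀ i, ((n - 1).choose k : ℝ) * τ ≤
      ∑ T : Finset (Fin n), (-1 : ℝ) ^ (T.card + k + 1) * p i T := by
    intro i
    have hi : i ∉ Finset.univ.erase i := Finset.notMem_erase i _
    -- Pair each `T` not containing `i` with `insert i T`; the two signs are opposite.
    have hsplit : ∑ T : Finset (Fin n), (-1 : ℝ) ^ (T.card + k + 1) * p i T =
        ∑ T ∈ (Finset.univ.erase i).powerset,
          (-1 : ℝ) ^ (T.card + k) * (p i (insert i T) - p i T) := by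
      rw [← Finset.powerset_univ, ← Finset.insert_erase (Finset.mem_univ i),
        Finset.sum_powerset_insert hi, Finset.insert_erase (Finset.mem_univ i),
        ← Finset.sum_add_distrib]
      refine Finset.sum_congr rfl fun T hT => ?_
      have hiT : i ∉ T := fun h => hi (Finset.mem_powerset.1 hT h)
      rw [Finset.card_insert_of_notMem hiT]
      ring
    have hcard : ((Finset.univ.erase i).powersetCard k).card = (n - 1).choose k := by
      rw [Finset.card_powersetCard, Finset.card_erase_of_mem (Finset.mem_univ i),
        Finset.card_univ, Fintype.card_fin]
    rw [hsplit, ← hcard, ← nsmul_eq_mul, ← Finset.sum_const]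
    refine (Finset.sum_le_sum fun T hT => ?_).trans_eq (Finset.sum_subset
      (fun T hT => Finset.mem_powerset.2 (Finset.mem_powersetCard.1 hT).1) fun T hT hk => ?_)
    · obtain ⟨hT, hk⟩ := Finset.mem_powersetCard.1 hT
      rw [hk, ← two_mul, pow_mul, neg_one_sq, one_pow, one_mul]
      exact hstep i T (fun h => hi (hT h)) hk
    · rw [Finset.mem_powerset] at hT
      rw [hconst i T (fun h => hi (hT h)) fun h => hk (Finset.mem_powersetCard.2 ⟨hT, h⟩)]
      simp
  calc (n : ℝ) * ((n - 1).choose k : ℝ) * τ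
      = ∑ _i : Fin n, ((n - 1).choose k : ℝ) * τ := by simp [mul_assoc]
    _ ≤ ∑ i, ∑ T : Finset (Fin n), (-1 : ℝ) ^ (T.card + k + 1) * p i T :=
        Finset.sum_le_sum fun i _ => key i
    _ = ∑ T : Finset (Fin n), (-1 : ℝ) ^ (T.card + k + 1) * ∑ i, p i T := by
        rw [Finset.sum_comm]; simp_rw [Finset.mul_sum]
    _ ≤ ∑ _T : Finset (Fin n), B := by
        refine Finset.sum_le_sum fun T _ => (le_abs_self _).trans ?_
        rw [abs_mul, abs_pow, abs_neg, abs_one, one_pow, one_mul]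
        exact hB T
    _ = 2 ^ n * B := by simp

/-- Row `n - 1` of Pascal's triangle has `n` entries, none above the middle one. -/
theorem Nat.two_pow_le_mul_choose_half {n : ℕ} (hn : 1 ≤ n) :
    2 ^ (n - 1) ≤ n * (n - 1).choose ((n - 1) / 2) := by
  calc 2 ^ (n - 1) = ∑ j ∈ Finset.range (n - 1 + 1), (n - 1).choose j :=
        (Nat.sum_range_choose _).symm
    _ ≤ ∑ _j ∈ Finset.range (n - 1 + 1), (n - 1).choose ((n - 1) / 2) :=
        Finset.sum_le_sum fun j _ => Nat.choose_le_middle j _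
    _ = n * (n - 1).choose ((n - 1) / 2) := by simp [Nat.sub_add_cancel hn]

/-! ### The lower bound for strategyproof mechanisms -/

namespace Mechanism

variable {n m : ℕ} {M : ℝ}

theorem le_inefficiency (μ : Mechanism n m M) (v : Profiles n m M) (a : Fin m) :
    ∑ i, v.1 i a - ∑ i, v.1 i (μ.choice v) ≤ μ.inefficiency v :=
  sub_le_sub_right (le_ciSup (f := fun a => ∑ i, v.1 i a) (Set.finite_range _).bddAbove a) _

theorem inefficiency_nonneg (μ : Mechanism n m M) (v : Profiles n m M) : 0 ≤ μ.inefficiency v := by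
  simpa using μ.le_inefficiency v (μ.choice v)

theorem Strategyproof.payment_eq {μ : Mechanism n m M} (h : μ.Strategyproof) {i : Fin n}
    {v v' : Profiles n m M} (hv : ∀ j, j ≠ i → v'.1 j = v.1 j)
    (hc : μ.choice v' = μ.choice v) : μ.payment i v' = μ.payment i v := by
  have h₁ := h i v v' hv
  have h₂ := h i v' v fun j hj => (hv j hj).symm
  rw [hc] at h₁ h₂
  linarith

/-- The profile in which `a` is worth `d i` to agent `i`, `b` is worth nothing, and every other
alternative is worth `-M / 4`. -/
noncomputable def pairProfile (a b : Fin m) (hM : 0 < M) (d : Fin n → ℝ)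
    (hd : ∀ i, d i ∈ Set.Ioo (-(M / 2)) (M / 2)) : Profiles n m M :=
  ⟨fun i x => if x = a then d i else if x = b then 0 else -(M / 4), fun i x => by
    dsimp only
    split_ifs
    · exact hd i
    · constructor <;> linarith
    · constructor <;> linarith⟩

section pairProfile

variable {μ : Mechanism n m M} {a b : Fin m} {hM : 0 < M} {d : Fin n → ℝ}
  {hd : ∀ i, d i ∈ Set.Ioo (-(M / 2)) (M / 2)} {δ : ℝ}

theorem sum_pairProfile_left : ∑ i, (pairProfile a b hM d hd).1 i a = ∑ i, d i := by
  simp [pairProfile]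

theorem sum_pairProfile_right (hab : a ≠ b) : ∑ i, (pairProfile a b hM d hd).1 i b = 0 := by
  simp [pairProfile, hab.symm]

/-- A third alternative falls short of `b` by `n * (M / 4)`, more than the allowed loss. -/
theorem choice_pairProfile_eq_left_or_right (hn : 1 ≤ n) (hab : a ≠ b)
    (hμ : ∀ v, μ.inefficiency v < δ) (hδ : δ ≤ M / 4) :
    μ.choice (pairProfile a b hM d hd) = a ∨ μ.choice (pairProfile a b hM d hd) = b := by
  by_contra! h
  have h₁ := μ.le_inefficiency (pairProfile a b hM d hd) b
  have h₂ := hμ (pairProfile a b hM d hd)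
  rw [sum_pairProfile_right hab] at h₁
  have h₃ : ∑ i, (pairProfile a b hM d hd).1 i (μ.choice (pairProfile a b hM d hd)) =
      n * -(M / 4) := by
    generalize μ.choice (pairProfile a b hM d hd) = x at h
    simp [pairProfile, h.1, h.2]
  rw [h₃] at h₁
  have : (1 : ℝ) ≤ n := by exact_mod_cast hn
  nlinarith

theorem choice_pairProfile_eq_right (hn : 1 ≤ n) (hab : a ≠ b)
    (hμ : ∀ v, μ.inefficiency v < δ) (hδ : δ ≤ M / 4) (hsum : ∑ i, d i ≤ -δ) :
    μ.choice (pairProfile a b hM d hd) = b := by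
  refine (choice_pairProfile_eq_left_or_right hn hab hμ hδ).resolve_left fun h => ?_
  have h₁ := μ.le_inefficiency (pairProfile a b hM d hd) b
  have h₂ := hμ (pairProfile a b hM d hd)
  rw [sum_pairProfile_right hab, h, sum_pairProfile_left] at h₁
  linarith

theorem choice_pairProfile_eq_left (hn : 1 ≤ n) (hab : a ≠ b)
    (hμ : ∀ v, μ.inefficiency v < δ) (hδ : δ ≤ M / 4) (hsum : δ ≤ ∑ i, d i) :
    μ.choice (pairProfile a b hM d hd) = a := by
  refine (choice_pairProfile_eq_left_or_right hn hab hμ hδ).resolve_right fun h => ?_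
  have h₁ := μ.le_inefficiency (pairProfile a b hM d hd) a
  have h₂ := hμ (pairProfile a b hM d hd)
  rw [sum_pairProfile_left, h, sum_pairProfile_right hab] at h₁
  linarith

end pairProfile

/-- A strategyproof mechanism cannot be both almost efficient and almost budget balanced. -/
theorem Strategyproof.exists_le_inefficiency_or_imbalance {μ : Mechanism n m M}
    (h : μ.Strategyproof) (hM : 0 < M) (hn : 2 ≤ n) (hm : 2 ≤ m) :
    ∃ v, M / 64 ≤ μ.inefficiency v ∨ M / 64 ≤ μ.imbalance v := by
  by_contra! hlt
  have hn₁ : 1 ≤ n := by omega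
  have hineff : ∀ v, μ.inefficiency v < M / 16 := fun v => (hlt v).1.trans (by linarith)
  have hδ : M / 16 ≤ M / 4 := by linarith
  obtain ⟨a, b, hab⟩ : ∃ a b : Fin m, a ≠ b :=
    ⟨⟨0, by omega⟩, ⟨1, by omega⟩, by simp⟩
  set k := (n - 1) / 2 with hk
  obtain ⟨l, hl⟩ : ∃ l, n = k + l + 1 := ⟨n - 1 - k, by omega⟩
  have hl₁ : (1 : ℝ) ≤ l := by exact_mod_cast (by omega : 1 ≤ l)
  have hkl : (k : ℝ) ≤ l := by exact_mod_cast (by omega : k ≤ l)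
  have hk₀ : (0 : ℝ) ≤ k := Nat.cast_nonneg k
  -- The low value `α` makes `k` high and `l` low agents total `-(M / 8)`. The one remaining agent
  -- is then pivotal: the total is `M / 8` if that agent is high and below `-(M / 8)` if low.
  obtain ⟨α, hα⟩ : ∃ α : ℝ, k * (M / 4) + l * α = -(M / 8) :=
    ⟨(-(M / 8) - k * (M / 4)) / l, by field_simp; ring⟩
  have hα₀ : α < 0 := by
    by_contra! h0
    nlinarith
  -- Uses `k ≤ l` and `1 ≤ l`; it keeps `α` inside the value range.
  have hα₁ : -(3 * M / 8) ≤ α := by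
    by_contra! h0
    nlinarith
  let d : Finset (Fin n) → Fin n → ℝ := fun T i => if i ∈ T then M / 4 else α
  have hd : ∀ T i, d T i ∈ Set.Ioo (-(M / 2)) (M / 2) := by
    intro T i
    simp only [d]
    split_ifs <;> constructor <;> linarith
  have hsum : ∀ T, ∑ i, d T i = -(M / 8) + α + ((T.card : ℝ) - k) * (M / 4 - α) := by
    intro T
    have h₁ : ∀ i, d T i = α + if i ∈ T then M / 4 - α else 0 := by
      intro i
      simp only [d]
      split_ifs <;> ring
    have h₂ : (n : ℝ) = k + l + 1 := by exact_mod_cast hl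
    simp only [h₁, Finset.sum_add_distrib, Finset.sum_ite_mem, Finset.univ_inter,
      Finset.sum_const, Finset.card_univ, Fintype.card_fin, nsmul_eq_mul, h₂]
    linear_combination hα
  let V : Finset (Fin n) → Profiles n m M := fun T => pairProfile a b hM (d T) (hd T)
  have hlow : ∀ T, T.card ≤ k → μ.choice (V T) = b := by
    intro T hT
    refine choice_pairProfile_eq_right hn₁ hab hineff hδ ?_
    have : (T.card : ℝ) ≤ k := by exact_mod_cast hT
    rw [hsum]
    nlinarith
  have hhigh : ∀ T, k < T.card → μ.choice (V T) = a := by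
    intro T hT
    refine choice_pairProfile_eq_left hn₁ hab hineff hδ ?_
    have : (k : ℝ) + 1 ≤ T.card := by exact_mod_cast hT
    rw [hsum]
    nlinarith
  have hV : ∀ i T, ∀ j, j ≠ i → (V (insert i T)).1 j = (V T).1 j := by
    intro i T j hj
    simp [V, d, pairProfile, hj]
  have hmain := Finset.mul_choose_le_of_alternating (k := k) (τ := M / 16) (B := M / 64)
    (fun i T => μ.payment i (V T)) ?_ ?_ fun T => (hlt (V T)).2.le
  · obtain ⟨r, rfl⟩ : ∃ r, n = r + 1 := ⟨n - 1, by omega⟩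
    have hchoose : (2 : ℝ) ^ r ≤ (r + 1 : ℕ) * ((r + 1 - 1).choose k : ℝ) := by
      -- With this, `hmain` would give `M / 16 ≤ 2 * (M / 64)`.
      exact_mod_cast Nat.two_pow_le_mul_choose_half hn₁
    have h₁ := mul_le_mul_of_nonneg_right hchoose (by positivity : 0 ≤ M / 16)
    have h₂ : 0 < (2 : ℝ) ^ r * M := by positivity
    rw [pow_succ] at hmain
    linarith
  · intro i T hi hT
    refine h.payment_eq (hV i T) ?_
    rcases lt_or_gt_of_ne hT with hT | hT
    · rw [hlow T hT.le, hlow _ (by rw [Finset.card_insert_of_notMem hi]; omega)]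
    · rw [hhigh T hT, hhigh _ (by rw [Finset.card_insert_of_notMem hi]; omega)]
  · intro i T hi hT
    -- Raise agent `i` from `α` only to `M / 16`: the total `-(M / 16)` still forces `b`, at the
    -- same payment as at `V T`. Not gaining by the report that leads to `a` bounds the jump below
    -- by `M / 16`.
    let e : Fin n → ℝ := fun j => d T j + if j = i then M / 16 - α else 0
    have he : ∀ j, e j ∈ Set.Ioo (-(M / 2)) (M / 2) := by
      intro j
      by_cases hj : j = i
      · subst hj
        simp only [e, d, hi, if_true, if_false]
        constructor <;> linarith
      · simpa [e, hj] using hd T j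
    have hesum : ∑ j, e j = -(M / 16) := by
      simp only [e, Finset.sum_add_distrib, hsum, hT, Finset.sum_ite_eq', Finset.mem_univ, if_true]
      ring
    have hec : μ.choice (pairProfile a b hM e he) = b :=
      choice_pairProfile_eq_right hn₁ hab hineff hδ hesum.le
    have heV : ∀ j, j ≠ i → (pairProfile a b hM e he).1 j = (V T).1 j := by
      intro j hj
      simp [V, e, pairProfile, hj]
    have hpay := h.payment_eq heV (hec.trans (hlow T hT.le).symm)
    have hic := h i (pairProfile a b hM e he) (V (insert i T)) fun j hj =>
      (hV i T j hj).trans (heV j hj).symm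
    rw [hec, hhigh _ (by rw [Finset.card_insert_of_notMem hi]; omega), hpay] at hic
    simp only [pairProfile, e, d, hi, if_true, if_false, hab.symm] at hic
    linarith

theorem ofReal_div_le_spilloverAt {μ : Mechanism n m M} (hM : 0 < M) (hn : 1 ≤ n) {lam c : ℝ}
    {v : Profiles n m M} (hv : c * M ≤ lam * μ.inefficiency v + (1 - lam) * μ.imbalance v) :
    ENNReal.ofReal (c / n) ≤ μ.spilloverAt lam := by
  have hn₀ : (0 : ℝ) < n := by exact_mod_cast hn
  have : c / n = c * M / (n * M) := by field_simp
  rw [this, ENNReal.ofReal_div_of_pos (by positivity)]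
  exact ENNReal.div_le_div_right ((ENNReal.ofReal_le_ofReal hv).trans
    (le_iSup (fun v => ENNReal.ofReal (lam * μ.inefficiency v + (1 - lam) * μ.imbalance v)) v)) _

theorem Strategyproof.le_spilloverAt {μ : Mechanism n m M} (h : μ.Strategyproof) (hM : 0 < M)
    (hn : 2 ≤ n) (hm : 2 ≤ m) {lam : ℝ} (h₀ : 0 < lam) (h₁ : lam < 1) :
    ENNReal.ofReal (min lam (1 - lam) / 64 / n) ≤ μ.spilloverAt lam := by
  obtain ⟨v, hv⟩ := h.exists_le_inefficiency_or_imbalance hM hn hm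
  refine ofReal_div_le_spilloverAt hM (by omega) (v := v) ?_
  have hT₁ := μ.inefficiency_nonneg v
  have hT₂ : 0 ≤ μ.imbalance v := abs_nonneg _
  have hl := min_le_left lam (1 - lam)
  have hr := min_le_right lam (1 - lam)
  rcases hv with hv | hv <;> nlinarith

/-! ### Clarke payments within a group of agents -/

/-- The choice maximizes the welfare of the agents in `G`, who pay their Clarke payments in
the economy of `G`. -/
structure IsClarke (G : Finset (Fin n)) (μ : Mechanism n m M) : Prop where
  efficient : ∀ (v : Profiles n m M) (a : Fin m),
    ∑ i ∈ G, v.1 i a ≤ ∑ i ∈ G, v.1 i (μ.choice v)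
  payment : ∀ (v : Profiles n m M), ∀ i ∈ G,
    μ.payment i v = (⨆ a : Fin m, ∑ j ∈ G.erase i, v.1 j a) -
      ∑ j ∈ G.erase i, v.1 j (μ.choice v)

namespace IsClarke

variable {μ : Mechanism n m M} {G : Finset (Fin n)}

/-- A member's utility is the welfare of `G` at the outcome minus a term free of its own report, so
truth-telling makes the mechanism maximize it. -/
theorem le_of_mem (h : IsClarke G μ) {i : Fin n} (hi : i ∈ G) {v v' : Profiles n m M}
    (hv : ∀ j, j ≠ i → v'.1 j = v.1 j) :
    v.1 i (μ.choice v') - μ.payment i v' ≤ v.1 i (μ.choice v) - μ.payment i v := by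
  have hrest : ∀ a, ∑ j ∈ G.erase i, v'.1 j a = ∑ j ∈ G.erase i, v.1 j a := fun a =>
    Finset.sum_congr rfl fun j hj => by rw [hv j (Finset.ne_of_mem_erase hj)]
  have hopt := h.efficient v (μ.choice v')
  rw [← Finset.add_sum_erase G _ hi, ← Finset.add_sum_erase G (fun j => v.1 j (μ.choice v)) hi]
    at hopt
  rw [h.payment v i hi, h.payment v' i hi]
  simp only [hrest]
  linarith

/-- At a tie-free profile, the chosen alternative is the only one that is optimal for `G`. -/
theorem eq_choice_of_tieFree (h : IsClarke G μ) (hG : G.Nonempty) {v : Profiles n m M}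
    (hv : μ.TieFree v) {b : Fin m} (hb : ∑ i ∈ G, v.1 i (μ.choice v) ≤ ∑ i ∈ G, v.1 i b) :
    b = μ.choice v := by
  by_contra hne
  -- Move all values of `b` slightly towards `M / 2`. This stays in the open range and makes `b`
  -- strictly better for `G`, yet tie-freeness keeps the old choice.
  let γ : ℝ → Fin n → Fin m → ℝ := fun t i a =>
    v.1 i a + if a = b then t * (M / 2 - v.1 i a) else 0
  have hγ : Continuous γ := by
    refine continuous_pi fun i => continuous_pi fun a => ?_
    by_cases ha : a = b
    · simp only [γ, if_pos ha]; fun_prop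
    · simp only [γ, if_neg ha]; fun_prop
  have hγ₀ : γ 0 = v.1 := by
    funext i a
    simp [γ]
  obtain ⟨U, hU, hUv⟩ := mem_nhds_subtype _ _ _ |>.1 hv
  have hmem : ∀ᶠ t in 𝓝[>] (0 : ℝ), γ t ∈ U :=
    (hγ.tendsto' 0 _ hγ₀).mono_left nhdsWithin_le_nhds hU
  obtain ⟨t, htU, ht₀, ht₁⟩ := (hmem.and (Ioo_mem_nhdsGT one_pos)).exists
  have hP : γ t ∈ Profiles n m M := by
    intro i a
    obtain ⟨h₁, h₂⟩ := v.2 i a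
    simp only [γ]
    split_ifs
    · constructor <;> nlinarith
    · constructor <;> linarith
  have hc : μ.choice ⟨γ t, hP⟩ = μ.choice v := hUv (show (⟨γ t, hP⟩ : Profiles n m M).1 ∈ U from htU)
  have hopt := h.efficient ⟨γ t, hP⟩ b
  rw [hc] at hopt
  have h₁ : ∑ i ∈ G, γ t i (μ.choice v) = ∑ i ∈ G, v.1 i (μ.choice v) := by
    simp [γ, Ne.symm hne]
  have h₂ : ∑ i ∈ G, v.1 i b < ∑ i ∈ G, γ t i b := by
    refine Finset.sum_lt_sum_of_nonempty hG fun i _ => ?_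
    have := (v.2 i b).2
    simp only [γ, if_true]
    nlinarith
  exact absurd (hopt.trans h₁.le) (not_le.2 (hb.trans_lt h₂))

theorem choice_permuteProfile (h : IsClarke G μ) (hG : G.Nonempty) (π : Equiv.Perm (Fin m))
    {v : Profiles n m M} (hv : μ.TieFree v) :
    π (μ.choice v) = μ.choice (permuteProfile π v) := by
  rw [← Equiv.eq_symm_apply]
  refine (h.eq_choice_of_tieFree hG hv ?_).symm
  simpa [permuteProfile] using h.efficient (permuteProfile π v) (π (μ.choice v))

theorem payment_permuteProfile (h : IsClarke G μ) (hG : G.Nonempty) (π : Equiv.Perm (Fin m))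
    {v : Profiles n m M} (hv : μ.TieFree v) {i : Fin n} (hi : i ∈ G) :
    μ.payment i (permuteProfile π v) = μ.payment i v := by
  rw [h.payment _ i hi, h.payment _ i hi, ← h.choice_permuteProfile hG π hv]
  congr 1
  · exact π.symm.iSup_comp (g := fun a => ∑ j ∈ G.erase i, v.1 j a)
  · simp [permuteProfile]

end IsClarke

theorem exists_forall_le_choice (hm : 1 ≤ m) (F : Fin m → ℝ) : ∃ a, ∀ b, F b ≤ F a :=
  have : Nonempty (Fin m) := ⟨⟨0, hm⟩⟩
  Finite.exists_max F

/-! ### The VCG mechanism -/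

theorem exists_isVCG (hm : 1 ≤ m) : ∃ μ : Mechanism n m M, μ.IsVCG := by
  choose argmax hargmax using exists_forall_le_choice hm
  exact ⟨⟨fun v => argmax fun a => ∑ i, v.1 i a, fun i v =>
    (⨆ a : Fin m, ∑ j ∈ Finset.univ.erase i, v.1 j a) -
      ∑ j ∈ Finset.univ.erase i, v.1 j (argmax fun a => ∑ i, v.1 i a)⟩,
    fun v => hargmax fun a => ∑ i, v.1 i a, fun _ _ => rfl⟩

namespace IsVCG

variable {μ : Mechanism n m M}

theorem isClarke (h : μ.IsVCG) : IsClarke Finset.univ μ :=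
  ⟨h.efficient, fun v i _ => h.clarke_payment v i⟩

theorem strategyproof (h : μ.IsVCG) : μ.Strategyproof :=
  fun i _ _ hv => h.isClarke.le_of_mem (Finset.mem_univ i) hv

theorem neutral (h : μ.IsVCG) (hn : 1 ≤ n) : μ.Neutral := fun π _ _ hv _ =>
  have hG : (Finset.univ : Finset (Fin n)).Nonempty := ⟨⟨0, hn⟩, Finset.mem_univ _⟩
  ⟨h.isClarke.choice_permuteProfile hG π hv,
    fun i => h.isClarke.payment_permuteProfile hG π hv (Finset.mem_univ i)⟩

theorem inefficiency_eq_zero (h : μ.IsVCG) (v : Profiles n m M) : μ.inefficiency v = 0 :=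
  have : Nonempty (Fin m) := ⟨μ.choice v⟩
  le_antisymm (sub_nonpos.2 (ciSup_le (h.efficient v))) (μ.inefficiency_nonneg v)

end IsVCG

/-! ### Sink mechanisms -/

theorem exists_isSinkMechanism (hm : 1 ≤ m) (s : Fin n) :
    ∃ μ : Mechanism n m M, μ.IsSinkMechanism s := by
  choose argmax hargmax using exists_forall_le_choice hm
  let f : Profiles n m M → Fin m := fun v => argmax fun a => ∑ i ∈ Finset.univ.erase s, v.1 i a
  let p : Fin n → Profiles n m M → ℝ := fun i v =>
    (⨆ a : Fin m, ∑ j ∈ (Finset.univ.erase s).erase i, v.1 j a) -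
      ∑ j ∈ (Finset.univ.erase s).erase i, v.1 j (f v)
  refine ⟨⟨f, fun i v => if i = s then -∑ j ∈ Finset.univ.erase s, p j v else p i v⟩,
    ?_, fun v => hargmax fun a => ∑ i ∈ Finset.univ.erase s, v.1 i a, ?_, ?_⟩
  · intro v v' hv
    have : ∀ a, ∑ i ∈ Finset.univ.erase s, v'.1 i a = ∑ i ∈ Finset.univ.erase s, v.1 i a :=
      fun a => Finset.sum_congr rfl fun j hj => by rw [hv j (Finset.ne_of_mem_erase hj)]
    simp only [f, this]
  · intro v i hi
    simp only [if_neg hi, p]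
  · intro v
    simp only [if_true]
    exact congrArg Neg.neg (Finset.sum_congr rfl fun j hj =>
      (if_neg (Finset.ne_of_mem_erase hj)).symm)

namespace IsSinkMechanism

variable {μ : Mechanism n m M} {s : Fin n}

theorem isClarke (h : μ.IsSinkMechanism s) : IsClarke (Finset.univ.erase s) μ :=
  ⟨h.efficient_without_sink, fun v i hi => h.payment_of_others v i (Finset.ne_of_mem_erase hi)⟩

theorem strategyproof (h : μ.IsSinkMechanism s) : μ.Strategyproof := by
  intro i v v' hv
  by_cases hi : i = s
  · subst hi
    -- The sink's report affects neither the outcome nor the others' payments, hence not its own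
    -- receipts.
    have hc := h.ignores_sink v v' hv
    have hp : ∀ j ∈ Finset.univ.erase i, μ.payment j v' = μ.payment j v := by
      intro j hj
      have hrest : ∀ a, ∑ l ∈ (Finset.univ.erase i).erase j, v'.1 l a =
          ∑ l ∈ (Finset.univ.erase i).erase j, v.1 l a := fun a =>
        Finset.sum_congr rfl fun l hl => by
          rw [hv l (Finset.ne_of_mem_erase (Finset.mem_of_mem_erase hl))]
      rw [h.isClarke.payment v' j hj, h.isClarke.payment v j hj]
      simp only [hrest, hc]
    rw [h.payment_of_sink v, h.payment_of_sink v', Finset.sum_congr rfl hp, hc]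
  · exact h.isClarke.le_of_mem (Finset.mem_erase.2 ⟨hi, Finset.mem_univ i⟩) hv

theorem neutral (h : μ.IsSinkMechanism s) (hn : 2 ≤ n) : μ.Neutral := by
  intro π v _ hv _
  have hG : (Finset.univ.erase s).Nonempty := by
    rw [← Finset.card_pos, Finset.card_erase_of_mem (Finset.mem_univ s), Finset.card_univ,
      Fintype.card_fin]
    omega
  have hp : ∀ i ∈ Finset.univ.erase s, μ.payment i (permuteProfile π v) = μ.payment i v :=
    fun i hi => h.isClarke.payment_permuteProfile hG π hv hi
  refine ⟨h.isClarke.choice_permuteProfile hG π hv, fun i => ?_⟩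
  by_cases hi : i = s
  · rw [hi, h.payment_of_sink, h.payment_of_sink, Finset.sum_congr rfl hp]
  · exact hp i (Finset.mem_erase.2 ⟨hi, Finset.mem_univ i⟩)

theorem budgetBalanced (h : μ.IsSinkMechanism s) : μ.BudgetBalanced := fun v => by
  rw [← Finset.add_sum_erase _ _ (Finset.mem_univ s), h.payment_of_sink, neg_add_cancel]

theorem imbalance_eq_zero (h : μ.IsSinkMechanism s) (v : Profiles n m M) : μ.imbalance v = 0 := by
  rw [imbalance, h.budgetBalanced v, abs_zero]

theorem inefficiency_le (h : μ.IsSinkMechanism s) (v : Profiles n m M) :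
    μ.inefficiency v ≤ M := by
  have : Nonempty (Fin m) := ⟨μ.choice v⟩
  refine sub_le_iff_le_add.2 (ciSup_le fun a => ?_)
  have hopt := h.efficient_without_sink v a
  rw [← Finset.add_sum_erase _ _ (Finset.mem_univ s),
    ← Finset.add_sum_erase _ (fun i => v.1 i (μ.choice v)) (Finset.mem_univ s)]
  have h₁ := (v.2 s a).2
  have h₂ := (v.2 s (μ.choice v)).1
  linarith

theorem exists_le_inefficiency (h : μ.IsSinkMechanism s) (hM : 0 < M) (hm : 2 ≤ m) {t : ℝ}
    (ht₀ : 0 < t) (ht₁ : t < 1) : ∃ v, t * M ≤ μ.inefficiency v := by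
  let o : Profiles n m M := ⟨fun _ _ => 0, fun _ _ => by constructor <;> linarith⟩
  -- Only the sink cares, and it dislikes exactly the alternative chosen at the zero profile.
  let w : Profiles n m M := ⟨fun i a => if i = s then
      if a = μ.choice o then -(t * M / 2) else t * M / 2 else 0, fun i a => by
    dsimp only
    split_ifs <;> constructor <;> nlinarith⟩
  have hc : μ.choice w = μ.choice o := h.ignores_sink o w fun j hj => by
    funext a
    simp [o, w, hj]
  have : Nontrivial (Fin m) := Fin.nontrivial_iff_two_le.2 hm
  obtain ⟨a, ha⟩ := exists_ne (μ.choice o)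
  refine ⟨w, le_trans (le_of_eq ?_) (μ.le_inefficiency w a)⟩
  rw [hc]
  simp [w, ha]

theorem spilloverAt_eq (h : μ.IsSinkMechanism s) (hM : 0 < M) (hm : 2 ≤ m) {lam : ℝ}
    (hlam : 0 ≤ lam) : μ.spilloverAt lam = ENNReal.ofReal (lam / n) := by
  have hn : 1 ≤ n := s.pos
  have hn₀ : (0 : ℝ) < n := by exact_mod_cast hn
  refine le_antisymm ?_ ?_
  · have : lam / n = lam * M / (n * M) := by field_simp
    rw [this, ENNReal.ofReal_div_of_pos (by positivity)]
    refine ENNReal.div_le_div_right (iSup_le fun v => ENNReal.ofReal_le_ofReal ?_) _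
    rw [h.imbalance_eq_zero, mul_zero, add_zero]
    exact mul_le_mul_of_nonneg_left (h.inefficiency_le v) hlam
  -- The value range is open, so the loss `M` is only approached: take losses `t * M` and let `t →
  -- 1`.
  · have hcont : Tendsto (fun t : ℝ => ENNReal.ofReal (lam * t / n)) (𝓝[<] 1)
        (𝓝 (ENNReal.ofReal (lam / n))) := by
      refine (Continuous.tendsto' ?_ 1 _ (by rw [mul_one])).mono_left nhdsWithin_le_nhds
      exact ENNReal.continuous_ofReal.comp (by fun_prop)
    refine le_of_tendsto hcont ?_
    filter_upwards [Ioo_mem_nhdsLT one_pos] with t ht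
    obtain ⟨v, hv⟩ := h.exists_le_inefficiency hM hm ht.1 ht.2
    refine ofReal_div_le_spilloverAt hM hn (v := v) ?_
    rw [h.imbalance_eq_zero, mul_zero, add_zero, mul_assoc]
    exact mul_le_mul_of_nonneg_left hv hlam

end IsSinkMechanism

/-! ### Limits of the spillover and the main theorem -/

theorem spilloverAt_eq_zero {μ : Mechanism n m M} {lam : ℝ}
    (h : ∀ v, lam * μ.inefficiency v + (1 - lam) * μ.imbalance v = 0) :
    μ.spilloverAt lam = 0 := by
  simp [spilloverAt, h]

theorem hasSpillover_of_forall_eq {lam : ℝ} {μ : ∀ M : ℝ, Mechanism n m M} {r : ℝ≥0∞}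
    (h : ∀ M, 0 < M → (μ M).spilloverAt lam = r) : HasSpillover lam μ r :=
  tendsto_const_nhds.congr' ((eventually_gt_atTop 0).mono fun M hM => (h M hM).symm)

end Mechanism

theorem theorem3 :
    -- for weights strictly between 0 and 1, the rate is at least of order 1/n, and this is tight
    (∀ lam : ℝ, 0 < lam → lam < 1 →
      (∃ c : ℝ, 0 < c ∧ ∀ n m : ℕ, 2 ≤ n → 2 ≤ m → ∀ μ : ∀ M : ℝ, Mechanism n m M,
        (∀ M : ℝ, 0 < M → (μ M).Strategyproof ∧ (μ M).Neutral) →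
        ENNReal.ofReal (c / n) ≤ liminf (fun M : ℝ => (μ M).spilloverAt lam) atTop) ∧
      (∀ n m : ℕ, 2 ≤ n → 2 ≤ m → ∀ s : Fin n, ∃ μ : ∀ M : ℝ, Mechanism n m M,
        (∀ M : ℝ, 0 < M → (μ M).IsSinkMechanism s ∧ (μ M).Strategyproof ∧ (μ M).Neutral) ∧
        Mechanism.HasSpillover lam μ (ENNReal.ofReal (lam / n)))) ∧
    -- weight 0: sink mechanisms
    (∀ n m : ℕ, 2 ≤ n → 1 ≤ m → ∀ s : Fin n,
      (∃ μ : ∀ M : ℝ, Mechanism n m M, ∀ M : ℝ, 0 < M → (μ M).IsSinkMechanism s) ∧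
      ∀ μ : ∀ M : ℝ, Mechanism n m M, (∀ M : ℝ, 0 < M → (μ M).IsSinkMechanism s) →
        (∀ M : ℝ, 0 < M →
          (μ M).Strategyproof ∧ (μ M).Neutral ∧ (μ M).BudgetBalanced) ∧
        Mechanism.HasSpillover 0 μ 0) ∧
    -- weight 1: the Vickrey-Clarke-Groves mechanism
    (∀ n m : ℕ, 1 ≤ n → 1 ≤ m →
      (∃ μ : ∀ M : ℝ, Mechanism n m M, ∀ M : ℝ, 0 < M → (μ M).IsVCG) ∧
      ∀ μ : ∀ M : ℝ, Mechanism n m M, (∀ M : ℝ, 0 < M → (μ M).IsVCG) →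
        (∀ M : ℝ, 0 < M → (μ M).Strategyproof ∧ (μ M).Neutral) ∧
        Mechanism.HasSpillover 1 μ 0) := by
  refine ⟨fun lam h₀ h₁ => ⟨⟨min lam (1 - lam) / 64, ?_, ?_⟩, ?_⟩, ?_, ?_⟩
  · have := lt_min h₀ (sub_pos.2 h₁)
    positivity
  · intro n m hn hm μ hμ
    refine le_liminf_of_le (by isBoundedDefault) ?_
    filter_upwards [eventually_gt_atTop 0] with M hM
    exact (hμ M hM).1.le_spilloverAt hM hn hm h₀ h₁
  · intro n m hn hm s
    choose μ hμ using fun M : ℝ =>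
      Mechanism.exists_isSinkMechanism (M := M) (one_le_two.trans hm) s
    exact ⟨μ, fun M _ => ⟨hμ M, (hμ M).strategyproof, (hμ M).neutral hn⟩,
      Mechanism.hasSpillover_of_forall_eq fun M hM => (hμ M).spilloverAt_eq hM hm h₀.le⟩
  · intro n m hn hm s
    choose μ hμ using fun M : ℝ => Mechanism.exists_isSinkMechanism (M := M) hm s
    refine ⟨⟨μ, fun M _ => hμ M⟩, fun μ hμ => ⟨fun M hM => ⟨(hμ M hM).strategyproof,
      (hμ M hM).neutral hn, (hμ M hM).budgetBalanced⟩, ?_⟩⟩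
    refine Mechanism.hasSpillover_of_forall_eq fun M hM =>
      Mechanism.spilloverAt_eq_zero fun v => ?_
    rw [(hμ M hM).imbalance_eq_zero]
    ring
  · intro n m hn hm
    choose μ hμ using fun M : ℝ => Mechanism.exists_isVCG (n := n) (M := M) hm
    refine ⟨⟨μ, fun M _ => hμ M⟩, fun μ hμ => ⟨fun M hM => ⟨(hμ M hM).strategyproof,
      (hμ M hM).neutral hn⟩, ?_⟩⟩
    refine Mechanism.hasSpillover_of_forall_eq fun M hM =>
      Mechanism.spilloverAt_eq_zero fun v => ?_
    rw [(hμ M hM).inefficiency_eq_zero]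
    ring
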